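/- Let $\mathbf p = 012102101021012101021012\cdots$ be the infinite word over $\{0,1,2\}$ that begins with $0$ and is fixed by the morphism $0\mapsto 01$, $1\mapsto 21$, $2\mapsto 0$. For $n\ge 0$ let $R(n)$ be the smallest positive integer $m$ such that every occurrence in $\mathbf p$ of a length-$n$ factor, say at position $i$, is followed by another occurrence of the same factor at a position $j$ with $i<j\le i+m$. Let $$\beta_1=\frac{(100+12\sqrt{69})^{1/3}}{6}+\frac{2}{3(100+12\sqrt{69})^{1/3}}+\frac23$$ (the unique real zero of $X^3-2X^2+X-1$), and let $\xi=2\beta_1^2-\beta_1+2$. Then $R(n)$ exists for every $n$, we have $R(n)\le \xi n$ for all integers $n\ge 1$, and $\xi\doteq 6.40431358$, with $|\xi-6.40431358|<10^{-8}$. -/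

import Mathlib

namespace PWord

/-- The morphism `0 → 01`, `1 → 21`, `2 → 0` on letters. -/
def h : Fin 3 → List (Fin 3) := ![[0, 1], [2, 1], [0]]

/-- The morphism extended to finite words by concatenation. -/
def hWord (w : List (Fin 3)) : List (Fin 3) := w.flatMap h

/-- The word obtained by applying the morphism `k` times to the one-letter word `0`. -/
def iter (k : ℕ) : List (Fin 3) := hWord^[k] [0]

theorem iter_succ (k : ℕ) : iter (k + 1) = hWord (iter k) := by
  simp only [iter, Function.iterate_succ_apply']

theorem length_le_hWord (w : List (Fin 3)) : w.length ≤ (hWord w).length := by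
  induction w with
  | nil => simp
  | cons a w ih =>
    have ha : 1 ≤ (h a).length := by fin_cases a <;> simp [h]
    have e : hWord (a :: w) = h a ++ hWord w := by simp [hWord]
    rw [e, List.length_append, List.length_cons]
    omega

/-- Every iterate begins with `0`, and its length exceeds the number of iterations. -/
theorem iter_spec (k : ℕ) : k < (iter k).length ∧ ∃ w, iter k = 0 :: w := by
  induction k with
  | zero => simp [iter]
  | succ k ih =>
    obtain ⟨hk, w, hw⟩ := ih
    have hl := length_le_hWord w
    have e : iter (k + 1) = 0 :: 1 :: hWord w := by
      rw [iter_succ, hw]; simp [hWord, h]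
    rw [hw] at hk
    rw [e]
    refine ⟨?_, _, rfl⟩
    simp only [List.length_cons] at hk ⊢
    omega

theorem lt_length_iter (k : ℕ) : k < (iter k).length := (iter_spec k).1

/-- The infinite word `p = 0121021010210...`: its letter at position `n` is the letter at
position `n` of the `n`-th iterate of the morphism on `0`. -/
def p (n : ℕ) : Fin 3 := (iter n)[n]'(lt_length_iter n)

theorem iter_isPrefix_succ (k : ℕ) : iter k <+: iter (k + 1) := by
  induction k with
  | zero => exact ⟨[1], by simp [iter, hWord, h]⟩
  | succ k ih =>
    obtain ⟨t, ht⟩ := ih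
    refine ⟨hWord t, ?_⟩
    have e : hWord (iter k ++ t) = hWord (iter k) ++ hWord t := by simp [hWord]
    rw [iter_succ (k + 1), ← ht, e, ht, iter_succ k]

theorem iter_isPrefix {k l : ℕ} (hkl : k ≤ l) : iter k <+: iter l := by
  induction l, hkl using Nat.le_induction with
  | base => exact List.prefix_refl _
  | succ l _ ih => exact ih.trans (iter_isPrefix_succ l)

/-- All iterates are prefixes of `p`. -/
theorem iter_getElem (k n : ℕ) (hn : n < (iter k).length) : (iter k)[n] = p n := by
  unfold p
  rcases le_total k n with hkn | hkn
  · exact (iter_isPrefix hkn).getElem hn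
  · exact ((iter_isPrefix hkn).getElem (lt_length_iter n)).symm

/-- `p` is a fixed point of the morphism: the image of every finite prefix of `p` is a
prefix of `p`. -/
theorem p_fixed (n i : ℕ) (hi : i < (hWord ((List.range n).map p)).length) :
    (hWord ((List.range n).map p))[i] = p i := by
  have hpre : (List.range n).map p <+: iter n := by
    have : (List.range n).map p = (iter n).take n := by
      apply List.ext_getElem
      · have := lt_length_iter n
        simp; omega
      · intro j h1 h2
        simp [iter_getElem]
    rw [this]
    exact List.take_prefix _ _
  obtain ⟨t, ht⟩ := hpre
  have h2 : hWord ((List.range n).map p) <+: iter (n + 1) := by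
    refine ⟨hWord t, ?_⟩
    rw [iter_succ, ← ht]
    simp [hWord]
  rw [h2.getElem hi, iter_getElem]

/-- The set of positive integers `m` such that every occurrence in `x` of a length-`n` factor
(at a position `i`) is followed by another occurrence of the same factor (at a position `j`)
at distance at most `m`. -/
def recurrenceBounds {α : Type*} (x : ℕ → α) (n : ℕ) : Set ℕ :=
  {m | 0 < m ∧ ∀ i, ∃ j, i < j ∧ j ≤ i + m ∧ ∀ t < n, x (j + t) = x (i + t)}

/-- The recurrence function of an infinite word: the smallest element of
`recurrenceBounds x n` (meaningful when that set is nonempty). -/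
noncomputable def recurrenceFunction {α : Type*} (x : ℕ → α) (n : ℕ) : ℕ :=
  sInf (recurrenceBounds x n)

/-- The real number `β₁ = 1.75487766...`. -/
noncomputable def beta1 : ℝ :=
  (100 + 12 * Real.sqrt 69) ^ (1 / 3 : ℝ) / 6
    + 2 / (3 * (100 + 12 * Real.sqrt 69) ^ (1 / 3 : ℝ)) + 2 / 3

/-- `β₁` is the unique real zero of `X³ - 2X² + X - 1`. -/
theorem beta1_iff (x : ℝ) : x ^ 3 - 2 * x ^ 2 + x - 1 = 0 ↔ x = beta1 := by
  have root : beta1 ^ 3 - 2 * beta1 ^ 2 + beta1 - 1 = 0 := by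
    have hs : Real.sqrt 69 ^ 2 = 69 := Real.sq_sqrt (by norm_num)
    have hpos : (0 : ℝ) < 100 + 12 * Real.sqrt 69 := by positivity
    unfold beta1
    set c : ℝ := (100 + 12 * Real.sqrt 69) ^ (1 / 3 : ℝ) with hc
    have cpos : 0 < c := Real.rpow_pos_of_pos hpos _
    have c3 : c ^ 3 = 100 + 12 * Real.sqrt 69 := by
      rw [hc, ← Real.rpow_natCast, ← Real.rpow_mul hpos.le]; norm_num
    have c6 : c ^ 6 - 200 * c ^ 3 + 64 = 0 := by
      have : c ^ 6 = (c ^ 3) ^ 2 := by ring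
      rw [this, c3]; nlinarith
    have e : (c / 6 + 2 / (3 * c) + 2 / 3) ^ 3 - 2 * (c / 6 + 2 / (3 * c) + 2 / 3) ^ 2
        + (c / 6 + 2 / (3 * c) + 2 / 3) - 1 = (c ^ 6 - 200 * c ^ 3 + 64) / (216 * c ^ 3) := by
      field_simp
      ring
    rw [e, c6, zero_div]
  have big : ∀ y : ℝ, y ^ 3 - 2 * y ^ 2 + y - 1 = 0 → 1 < y := by
    intro y hy
    by_contra hle
    push Not at hle
    nlinarith [mul_nonneg (sub_nonneg.2 hle) (sq_nonneg (y - 1)), sq_nonneg (y - 1)]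
  constructor
  · intro hx
    have h1 := big x hx
    have h2 := big _ root
    have : (x - beta1) * ((x - 1) * (x - 1) + (beta1 - 1) * (beta1 - 1) + (x - 1) * (beta1 - 1)
        + (x - 1) + (beta1 - 1)) = 0 := by linear_combination hx - root
    rcases mul_eq_zero.1 this with h0 | h0
    · linarith
    · have a := sub_pos.2 h1
      have b := sub_pos.2 h2
      have : 0 < (x - 1) * (x - 1) + (beta1 - 1) * (beta1 - 1) + (x - 1) * (beta1 - 1)
        + (x - 1) + (beta1 - 1) := by positivity
      linarith
  · rintro rfl
    exact root

/-- The constant `ξ = 2β₁² - β₁ + 2`. -/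
noncomputable def xi : ℝ := 2 * beta1 ^ 2 - beta1 + 2

end PWord

namespace PWord

/-! A window of `p` either lies in a window whose content is known to return soon, or contains a
known bispecial factor with a spare letter on each side (`Dichotomy`). If that factor has Parikh
vector `u`, windows shorter than `size u + 2` must fall in the first case, which bounds the
recurrence function by the size of the return vector.

Such a dichotomy passes through the morphism: images of windows extend by forced letters, and Parikh
vectors, unlike lengths alone, transform linearly, so `Level.succ` turns one level into the next.
Finite checks for the factors `1` and `10` start two chains, whose bounds together cover every
length at least 3.

It remains to compare two linear recurrences with characteristic polynomial X³ - 2X² + X - 1. The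
constant ξ is the ratio of their dominant parts, so the error is governed by the complex roots, of
modulus less than 1, and the slack in the `+ 2` absorbs it. -/

/-! ### Factors and the positions of letter images. -/

/-- The factor of `p` of length `n` at position `i`. -/
def word (i n : ℕ) : List (Fin 3) := (List.range n).map fun t => p (i + t)

theorem length_word (i n : ℕ) : (word i n).length = n := by simp [word]

theorem getElem_word (i n t : ℕ) (ht : t < (word i n).length) : (word i n)[t] = p (i + t) := by
  simp [word]

theorem word_add (i m n : ℕ) : word i (m + n) = word i m ++ word (i + m) n := by
  simp [word, List.range_add, Function.comp_def, Nat.add_assoc]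

theorem word_one (i : ℕ) : word i 1 = [p i] := by simp [word]

theorem word_two (i : ℕ) : word i 2 = [p i, p (i + 1)] := by simp [word, List.range_succ]

theorem word_eq_iff {i j n : ℕ} : word i n = word j n ↔ ∀ t < n, p (i + t) = p (j + t) := by
  simp [word]

theorem take_word {i m n : ℕ} (hmn : m ≤ n) : (word i n).take m = word i m := by
  obtain ⟨k, rfl⟩ := Nat.exists_eq_add_of_le hmn
  rw [word_add, List.take_left' (length_word i m)]

theorem drop_word (i m n : ℕ) : (word i (m + n)).drop m = word (i + m) n := by
  rw [word_add, List.drop_left' (length_word i m)]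

theorem hWord_append (v w : List (Fin 3)) : hWord (v ++ w) = hWord v ++ hWord w := by
  simp [hWord]

/-- The length of the image of the prefix of length `n` of `p`. -/
def imgPos (n : ℕ) : ℕ := (hWord (word 0 n)).length

theorem hWord_word_zero (n : ℕ) : hWord (word 0 n) = word 0 (imgPos n) := by
  apply List.ext_getElem
  · rw [length_word]; rfl
  · intro t h1 h2
    have e : word 0 n = (List.range n).map p := by simp [word]
    rw [getElem_word]
    simp only [e, p_fixed, Nat.zero_add]

theorem imgPos_add (m n : ℕ) : imgPos (m + n) = imgPos m + (hWord (word m n)).length := by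
  simp [imgPos, word_add, hWord_append]

theorem hWord_word (m n : ℕ) : hWord (word m n) = word (imgPos m) (imgPos (m + n) - imgPos m) := by
  have e := hWord_word_zero (m + n)
  rw [word_add, hWord_append, hWord_word_zero, imgPos_add, word_add] at e
  rw [imgPos_add, Nat.add_sub_cancel_left]
  simpa using List.append_cancel_left e

theorem imgPos_zero : imgPos 0 = 0 := rfl

theorem imgPos_succ (n : ℕ) : imgPos (n + 1) = imgPos n + (h (p n)).length := by
  rw [imgPos_add, word_one]; simp [hWord]

theorem letter_cases (n : ℕ) : p n = 0 ∨ p n = 1 ∨ p n = 2 := by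
  generalize p n = x
  fin_cases x <;> simp

theorem word_imgPos (n : ℕ) : word (imgPos n) (h (p n)).length = h (p n) := by
  have e := hWord_word n 1
  rw [word_one, imgPos_succ, Nat.add_sub_cancel_left] at e
  rw [← e]; simp [hWord]

theorem img_zero {n : ℕ} (hn : p n = 0) :
    p (imgPos n) = 0 ∧ p (imgPos n + 1) = 1 ∧ imgPos (n + 1) = imgPos n + 2 := by
  have e := word_imgPos n
  have e' := imgPos_succ n
  rw [hn] at e e'
  simp only [h, Matrix.cons_val_zero, List.length_cons, List.length_nil, Nat.zero_add,
    Nat.reduceAdd, word_two, List.cons.injEq] at e e'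
  exact ⟨e.1, e.2.1, e'⟩

theorem img_one {n : ℕ} (hn : p n = 1) :
    p (imgPos n) = 2 ∧ p (imgPos n + 1) = 1 ∧ imgPos (n + 1) = imgPos n + 2 := by
  have e := word_imgPos n
  have e' := imgPos_succ n
  rw [hn] at e e'
  simp only [h, Matrix.cons_val_one, Matrix.cons_val_zero, List.length_cons, List.length_nil,
    Nat.zero_add, Nat.reduceAdd, word_two, List.cons.injEq] at e e'
  exact ⟨e.1, e.2.1, e'⟩

theorem img_two {n : ℕ} (hn : p n = 2) :
    p (imgPos n) = 0 ∧ imgPos (n + 1) = imgPos n + 1 := by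
  have e := word_imgPos n
  have e' := imgPos_succ n
  rw [hn] at e e'
  simp only [h, Matrix.cons_val, List.length_cons, List.length_nil, Nat.zero_add, word_one,
    List.cons.injEq] at e e'
  exact ⟨e.1, e'⟩

theorem imgPos_strictMono : StrictMono imgPos := by
  apply strictMono_nat_of_lt_succ
  intro n
  rcases letter_cases n with hn | hn | hn
  · have := (img_zero hn).2.2; omega
  · have := (img_one hn).2.2; omega
  · have := (img_two hn).2; omega

theorem exists_between {f : ℕ → ℕ} (hf : StrictMono f) (h0 : f 0 = 0) (i : ℕ) :
    ∃ m, f m ≤ i ∧ i < f (m + 1) := by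
  have hex : ∃ m, i < f m := ⟨i + 1, (Nat.lt_succ_self i).trans_le hf.le_apply⟩
  obtain ⟨m, hm⟩ : ∃ m, Nat.find hex = m + 1 := by
    refine Nat.exists_eq_succ_of_ne_zero fun h => ?_
    have := Nat.find_spec hex
    rw [h, h0] at this
    omega
  refine ⟨m, ?_, hm ▸ Nat.find_spec hex⟩
  have := Nat.find_min hex (m := m) (by omega)
  omega

theorem p_zero : p 0 = 0 := by decide

/-! ### Adjacent letters and covering by iterated images. -/

/-- The pairs of letters that occur in `p` at adjacent positions. -/
def adjacent : List (Fin 3 × Fin 3) := [(0, 1), (0, 2), (1, 0), (1, 2), (2, 1)]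

theorem adjacent_p (n : ℕ) : (p n, p (n + 1)) ∈ adjacent := by
  induction n using Nat.strong_induction_on with
  | _ n ih =>
    obtain ⟨m, hm, hm'⟩ := exists_between imgPos_strictMono imgPos_zero n
    have hle : m ≤ imgPos m := imgPos_strictMono.le_apply
    -- The block containing `n` has a smaller index, since the first block has length 2; only `n =
    -- 0` escapes, and there the pair lies inside the block `01`.
    have hlt : n = imgPos m ∧ p m ≠ 2 ∨ m < n := by
      rcases Nat.eq_zero_or_pos m with rfl | hpos
      · rw [imgPos_zero, p_zero]
        by_cases h0 : n = 0
        · left; subst h0; decide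
        · right; omega
      · right
        have h1 := imgPos_strictMono.add_le_nat (m - 1) 1
        have h2 := (img_zero p_zero).2.2
        rw [Nat.sub_add_cancel hpos] at h1
        rw [imgPos_zero] at h2
        simp only [Nat.zero_add] at h2
        omega
    have nextm := ih m
    rcases letter_cases m with h0 | h0 | h0
    · obtain ⟨a1, a2, a3⟩ := img_zero h0
      rcases (show n = imgPos m ∨ n = imgPos m + 1 by omega) with rfl | rfl
      · rw [a1, a2]; decide
      · have nm := nextm (by omega)
        rw [a2, show imgPos m + 1 + 1 = imgPos (m + 1) by omega]
        rw [h0] at nm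
        rcases letter_cases (m + 1) with h1 | h1 | h1
        · rw [h1] at nm; exact absurd nm (by decide)
        · rw [(img_one h1).1]; decide
        · rw [(img_two h1).1]; decide
    · obtain ⟨a1, a2, a3⟩ := img_one h0
      rcases (show n = imgPos m ∨ n = imgPos m + 1 by omega) with rfl | rfl
      · rw [a1, a2]; decide
      · have nm := nextm (by omega)
        rw [a2, show imgPos m + 1 + 1 = imgPos (m + 1) by omega]
        rw [h0] at nm
        rcases letter_cases (m + 1) with h1 | h1 | h1
        · rw [(img_zero h1).1]; decide
        · rw [h1] at nm; exact absurd nm (by decide)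
        · rw [(img_two h1).1]; decide
    · obtain ⟨a1, a3⟩ := img_two h0
      obtain rfl : n = imgPos m := by omega
      have nm := nextm (by rcases hlt with hlt | hlt; exacts [absurd h0 hlt.2, hlt])
      rw [a1, show imgPos m + 1 = imgPos (m + 1) by omega]
      rw [h0] at nm
      rcases letter_cases (m + 1) with h1 | h1 | h1
      · rw [h1] at nm; exact absurd nm (by decide)
      · rw [(img_one h1).1]; decide
      · rw [h1] at nm; exact absurd nm (by decide)

theorem iterate_hWord_word (K m n : ℕ) :
    hWord^[K] (word m n) = word (imgPos^[K] m) (imgPos^[K] (m + n) - imgPos^[K] m) := by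
  induction K with
  | zero => simp
  | succ K ih =>
    have hle : imgPos^[K] m ≤ imgPos^[K] (m + n) :=
      (imgPos_strictMono.iterate K).monotone (Nat.le_add_right m n)
    simp only [Function.iterate_succ_apply']
    rw [ih, hWord_word, Nat.add_sub_cancel' hle]

/-- Every factor of `p` occurs in the `K`-th image of a pair of adjacent letters, starting in the
image of the first letter. -/
theorem exists_drop_iterate (K i : ℕ) : ∃ x ∈ adjacent, ∃ off < (hWord^[K] [x.1]).length,
    ∃ n, (hWord^[K] [x.1, x.2]).drop off = word i n := by
  have mono := imgPos_strictMono.iterate K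
  have h0 : imgPos^[K] 0 = 0 := Function.iterate_fixed imgPos_zero K
  obtain ⟨m, hm, hm'⟩ := exists_between mono h0 i
  have hm2 : imgPos^[K] (m + 1) < imgPos^[K] (m + 2) := mono (Nat.lt_succ_self _)
  refine ⟨_, adjacent_p m, i - imgPos^[K] m, ?_, imgPos^[K] (m + 2) - i, ?_⟩
  · rw [← word_one, iterate_hWord_word, length_word]
    omega
  · rw [← word_two, iterate_hWord_word,
      show imgPos^[K] (m + 2) - imgPos^[K] m
        = (i - imgPos^[K] m) + (imgPos^[K] (m + 2) - i) by omega, drop_word,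
      Nat.add_sub_cancel' hm]

/-! ### Letter counts and forced extensions. -/

/-- The number of occurrences of the letter `x` in the prefix of length `n` of `p`. -/
def cnt (x : Fin 3) (n : ℕ) : ℕ := (word 0 n).count x

theorem cnt_add (x : Fin 3) (m n : ℕ) : cnt x (m + n) = cnt x m + (word m n).count x := by
  simp [cnt, word_add]

theorem cnt_succ (x : Fin 3) (n : ℕ) : cnt x (n + 1) = cnt x n + if p n = x then 1 else 0 := by
  rw [cnt_add, word_one, List.count_singleton]
  simp

theorem cnt_sum (n : ℕ) : cnt 0 n + cnt 1 n + cnt 2 n = n := by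
  induction n with
  | zero => rfl
  | succ n ih =>
    simp only [cnt_succ]
    rcases letter_cases n with hn | hn | hn <;> simp [hn] <;> omega

theorem cnt_imgPos (n : ℕ) : cnt 0 (imgPos n) = cnt 0 n + cnt 2 n ∧
    cnt 1 (imgPos n) = cnt 0 n + cnt 1 n ∧ cnt 2 (imgPos n) = cnt 1 n := by
  induction n with
  | zero => decide
  | succ n ih =>
    rw [imgPos_succ]
    simp only [cnt_add, word_imgPos, word_one]
    rcases letter_cases n with hn | hn | hn <;> simp [hn, h] <;> omega

/-- The left end of the maximal forced extension of the image of a window starting at `i`. -/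
def lo (i : ℕ) : ℕ := if p i = 2 then imgPos i - 1 else imgPos i

/-- The right end of the maximal forced extension of the image of a window ending before `j`. -/
def hi (j : ℕ) : ℕ := if p (j - 1) = 1 then imgPos j + 1 else imgPos j

/-- A 2 is preceded by 0 or 1, and both images end in 1. -/
theorem lo_of_eq_two {i : ℕ} (hi : p i = 2) :
    imgPos i = lo i + 1 ∧ p (lo i) = 1 := by
  obtain ⟨m, rfl⟩ : ∃ m, i = m + 1 := by
    refine Nat.exists_eq_succ_of_ne_zero ?_
    rintro rfl
    exact absurd hi (by decide)
  have ha := adjacent_p m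
  rw [hi] at ha
  simp only [lo, hi, if_true]
  rcases letter_cases m with h0 | h0 | h0
  · obtain ⟨-, a2, a3⟩ := img_zero h0
    rw [a3]; exact ⟨rfl, a2⟩
  · obtain ⟨-, a2, a3⟩ := img_one h0
    rw [a3]; exact ⟨rfl, a2⟩
  · rw [h0] at ha; exact absurd ha (by decide)

theorem lo_of_ne_two {i : ℕ} (hi : p i ≠ 2) : lo i = imgPos i := by simp [lo, hi]

/-- A 1 is followed by 0 or 2, and both images begin with 0. -/
theorem hi_of_eq_one {j : ℕ} (hj : p j = 1) :
    hi (j + 1) = imgPos (j + 1) + 1 ∧ p (imgPos (j + 1)) = 0 := by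
  refine ⟨by simp [hi, hj], ?_⟩
  have ha := adjacent_p j
  rw [hj] at ha
  rcases letter_cases (j + 1) with h0 | h0 | h0
  · exact (img_zero h0).1
  · rw [h0] at ha; exact absurd ha (by decide)
  · exact (img_two h0).1

theorem hi_of_ne_one {j : ℕ} (hj : p j ≠ 1) : hi (j + 1) = imgPos (j + 1) := by simp [hi, hj]

theorem lo_le (i : ℕ) : lo i ≤ imgPos i := by unfold lo; split_ifs <;> omega

theorem le_hi (i : ℕ) : imgPos i ≤ hi i := by unfold hi; split_ifs <;> omega

theorem lo_strictMono : StrictMono lo := by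
  apply strictMono_nat_of_lt_succ
  intro n
  have hle := lo_le n
  by_cases h1 : p (n + 1) = 2
  · have e := (lo_of_eq_two h1).1
    rcases letter_cases n with hn | hn | hn
    · have := (img_zero hn).2.2; omega
    · have := (img_one hn).2.2; omega
    · have ha := adjacent_p n
      rw [hn, h1] at ha; exact absurd ha (by decide)
  · rw [lo_of_ne_two h1]
    exact hle.trans_lt (imgPos_strictMono n.lt_succ_self)

theorem hi_monotone : Monotone hi := by
  apply monotone_nat_of_le_succ
  intro n
  have h1 : imgPos n < imgPos (n + 1) := imgPos_strictMono n.lt_succ_self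
  have h2 := le_hi (n + 1)
  have h3 : hi n ≤ imgPos n + 1 := by unfold hi; split_ifs <;> omega
  omega

/-! ### Transfer of dichotomies and returns through the morphism. -/

/-- Every window `[i, j)` lies in a window of the family `A`, or contains a window of the family
`B` with at least one more letter on both sides. -/
def Dichotomy (A B : ℕ → ℕ → Prop) : Prop :=
  ∀ i j, i < j → (∃ a b, A a b ∧ a ≤ i ∧ j ≤ b) ∨ ∃ a b, B a b ∧ i < a ∧ b < j

/-- The maximal forced extensions of the images of a family of windows. -/
def extImage (A : ℕ → ℕ → Prop) (a b : ℕ) : Prop := ∃ a' b', A a' b' ∧ a = lo a' ∧ b = hi b'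

/-- The window is pulled back to the smallest one whose extended image covers it. Minimality at each
end makes a strict inclusion upstairs strict downstairs. -/
theorem Dichotomy.extImage {A B : ℕ → ℕ → Prop} (hAB : Dichotomy A B)
    (hB : ∀ a b, B a b → a < b) : Dichotomy (extImage A) (extImage B) := by
  intro i j hij
  obtain ⟨i', h1, h2⟩ := exists_between lo_strictMono (by decide) i
  have hex : ∃ j', j ≤ hi j' := ⟨j, imgPos_strictMono.le_apply.trans (le_hi j)⟩
  have hj := Nat.find_spec hex
  have hmin := fun m => Nat.find_min hex (m := m)
  set j' := Nat.find hex
  -- The maximum only keeps the window nonempty: when it contains `[a, b)` strictly, `i' < a < b`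
  -- forces `b < j'`.
  rcases hAB i' (max j' (i' + 1)) (by omega) with ⟨a, b, hA, ha, hb⟩ | ⟨a, b, hb, ha, hb'⟩
  · exact Or.inl ⟨_, _, ⟨a, b, hA, rfl, rfl⟩, (lo_strictMono.monotone ha).trans h1,
      hj.trans (hi_monotone ((le_max_left _ _).trans hb))⟩
  · have hlt := hB a b hb
    refine Or.inr ⟨_, _, ⟨a, b, hb, rfl, rfl⟩, h2.trans_le (lo_strictMono.monotone ha), ?_⟩
    have := hmin b (by omega)
    omega

/-- The factor in the window `[a, b)` occurs again after a return word whose Parikh vector is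
at most `v`. -/
def ReturnsWithin (v : ℕ × ℕ × ℕ) (a b : ℕ) : Prop :=
  ∃ a', a < a' ∧ word a' (b - a) = word a (b - a) ∧
    cnt 0 a' ≤ cnt 0 a + v.1 ∧ cnt 1 a' ≤ cnt 1 a + v.2.1 ∧ cnt 2 a' ≤ cnt 2 a + v.2.2

/-- The action of the morphism on Parikh vectors. -/
def parikhMap (v : ℕ × ℕ × ℕ) : ℕ × ℕ × ℕ := (v.1 + v.2.2, v.1 + v.2.1, v.2.1)

theorem cnt_imgPos_of_eq_two {i : ℕ} (h2 : p i = 2) : cnt 0 (imgPos i) = cnt 0 (lo i) ∧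
    cnt 1 (imgPos i) = cnt 1 (lo i) + 1 ∧ cnt 2 (imgPos i) = cnt 2 (lo i) := by
  obtain ⟨e, e1⟩ := lo_of_eq_two h2
  rw [e]; simp [cnt_succ, e1]

/-- Equal factors have equal images, and their end letters agree, so both images receive the same
forced extension. The left shift is the same too, so the return word is the image of the old one up
to conjugation. -/
theorem ReturnsWithin.extImage {v : ℕ × ℕ × ℕ} {a b : ℕ} (hab : a < b)
    (hr : ReturnsWithin v a b) : ReturnsWithin (parikhMap v) (lo a) (hi b) := by
  obtain ⟨a', haa, hw, h0, h1, h2⟩ := hr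
  have hlet : ∀ t < b - a, p (a' + t) = p (a + t) := word_eq_iff.1 hw
  have ha : p a' = p a := hlet 0 (by omega)
  have hb : p (a' + (b - a) - 1) = p (b - 1) := by
    have := hlet (b - a - 1) (by omega)
    rwa [show a' + (b - a - 1) = a' + (b - a) - 1 by omega,
      show a + (b - a - 1) = b - 1 by omega] at this
  have hW := hWord_word a' (b - a)
  rw [hw, hWord_word, Nat.add_sub_cancel' hab.le] at hW
  have hlen := congrArg List.length hW
  rw [length_word, length_word] at hlen
  rw [← hlen, word_eq_iff] at hW
  have m1 : imgPos a < imgPos b := imgPos_strictMono hab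
  have m2 : imgPos a' < imgPos (a' + (b - a)) := imgPos_strictMono (by omega)
  refine ⟨lo a', lo_strictMono haa, word_eq_iff.2 fun t ht => ?_, ?_⟩
  · have hlo : ∃ s, s ≤ 1 ∧ imgPos a = lo a + s ∧ imgPos a' = lo a' + s ∧
        (0 < s → p (lo a') = p (lo a)) := by
      by_cases hs : p a = 2
      · have e1 := lo_of_eq_two hs
        have e2 := lo_of_eq_two (ha.trans hs)
        exact ⟨1, le_rfl, e1.1, e2.1, fun _ => e2.2.trans e1.2.symm⟩
      · exact ⟨0, by omega, (lo_of_ne_two hs).symm, (lo_of_ne_two (ha ▸ hs)).symm, by omega⟩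
    obtain ⟨s, hs1, e1, e2, hs⟩ := hlo
    rcases lt_or_ge t s with hts | hts
    · obtain rfl : t = 0 := by omega
      exact hs hts
    · rcases lt_or_ge (lo a + t) (imgPos b) with hlt | hge
      · have := hW (t - s) (by omega)
        rw [show lo a' + t = imgPos a' + (t - s) by omega,
          show lo a + t = imgPos a + (t - s) by omega]
        exact this.symm
      · have hb1 : p (b - 1) = 1 := by
          by_contra hne
          rw [hi, if_neg hne] at ht
          omega
        obtain ⟨c, rfl⟩ : ∃ c, b = c + 1 := ⟨b - 1, by omega⟩
        obtain ⟨c', hc'⟩ : ∃ c', a' + (c + 1 - a) = c' + 1 := ⟨a' + (c + 1 - a) - 1, by omega⟩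
        rw [hc', Nat.add_sub_cancel, Nat.add_sub_cancel] at hb
        rw [Nat.add_sub_cancel] at hb1
        have f1 := hi_of_eq_one hb1
        have f2 := hi_of_eq_one (hb.trans hb1)
        rw [hc'] at hlen
        rw [show lo a + t = imgPos (c + 1) by omega,
          show lo a' + t = imgPos (c' + 1) by omega, f1.2, f2.2]
  · obtain ⟨i0, i1, i2⟩ := cnt_imgPos a
    obtain ⟨j0, j1, j2⟩ := cnt_imgPos a'
    simp only [parikhMap]
    by_cases hs : p a = 2
    · have e1 := cnt_imgPos_of_eq_two hs
      have e2 := cnt_imgPos_of_eq_two (ha.trans hs)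
      omega
    · rw [lo_of_ne_two hs, lo_of_ne_two (ha ▸ hs)]
      omega

/-- There is a dichotomy in which the windows of the first family return within `v`, and those of
the second have Parikh vector `u`, first letter `x` and last letter `y`. -/
def Level (v u : ℕ × ℕ × ℕ) (x y : Fin 3) : Prop :=
  ∃ A B : ℕ → ℕ → Prop, Dichotomy A B ∧ (∀ a b, A a b → a < b ∧ ReturnsWithin v a b) ∧
    ∀ a b, B a b → a < b ∧ p a = x ∧ p (b - 1) = y ∧
      cnt 0 b = cnt 0 a + u.1 ∧ cnt 1 b = cnt 1 a + u.2.1 ∧ cnt 2 b = cnt 2 a + u.2.2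

theorem lo_lt_hi {a b : ℕ} (hab : a < b) : lo a < hi b :=
  (lo_le a).trans_lt ((imgPos_strictMono hab).trans_le (le_hi b))

theorem p_lo (a : ℕ) : p (lo a) = ![0, 2, 1] (p a) := by
  rcases letter_cases a with ha | ha | ha
  · rw [lo_of_ne_two (by rw [ha]; decide), (img_zero ha).1, ha]; rfl
  · rw [lo_of_ne_two (by rw [ha]; decide), (img_one ha).1, ha]; rfl
  · rw [(lo_of_eq_two ha).2, ha]; rfl

theorem p_hi {b : ℕ} (hb : 0 < b) : p (hi b - 1) = ![1, 0, 0] (p (b - 1)) := by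
  obtain ⟨c, rfl⟩ : ∃ c, b = c + 1 := ⟨b - 1, by omega⟩
  rw [Nat.add_sub_cancel]
  rcases letter_cases c with ha | ha | ha
  · rw [hi_of_ne_one (by rw [ha]; decide), (img_zero ha).2.2, ha,
      show imgPos c + 2 - 1 = imgPos c + 1 by omega, (img_zero ha).2.1]; rfl
  · rw [(hi_of_eq_one ha).1, Nat.add_sub_cancel, (hi_of_eq_one ha).2, ha]; rfl
  · rw [hi_of_ne_one (by rw [ha]; decide), (img_two ha).2, Nat.add_sub_cancel, (img_two ha).1, ha]
    rfl

/-- The end letters decide which forced letters are added: a final 1 gives an extra 0, an initial 2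
an extra 1. -/
theorem Level.succ {v u : ℕ × ℕ × ℕ} {x y : Fin 3} (hl : Level v u x y) :
    Level (parikhMap v)
      (parikhMap u + (if y = 1 then (1, 0, 0) else 0) + (if x = 2 then (0, 1, 0) else 0))
      (![0, 2, 1] x) (![1, 0, 0] y) := by
  obtain ⟨A, B, hD, hA, hB⟩ := hl
  refine ⟨extImage A, extImage B, hD.extImage fun a b hb => (hB a b hb).1, ?_, ?_⟩
  · rintro _ _ ⟨a, b, hab, rfl, rfl⟩
    obtain ⟨hlt, hr⟩ := hA a b hab
    exact ⟨lo_lt_hi hlt, hr.extImage hlt⟩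
  · rintro _ _ ⟨a, b, hab, rfl, rfl⟩
    obtain ⟨hlt, hx, hy, c0, c1, c2⟩ := hB a b hab
    refine ⟨lo_lt_hi hlt, by rw [p_lo, hx], by rw [p_hi (by omega), hy], ?_⟩
    obtain ⟨i0, i1, i2⟩ := cnt_imgPos a
    obtain ⟨j0, j1, j2⟩ := cnt_imgPos b
    have hl : cnt 0 (imgPos a) = cnt 0 (lo a) ∧
        cnt 1 (imgPos a) = cnt 1 (lo a) + (if x = 2 then 1 else 0) ∧
        cnt 2 (imgPos a) = cnt 2 (lo a) := by
      split_ifs with h2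
      · exact cnt_imgPos_of_eq_two (hx.trans h2)
      · rw [lo_of_ne_two (hx ▸ h2)]; simp
    have hr : cnt 0 (hi b) = cnt 0 (imgPos b) + (if y = 1 then 1 else 0) ∧
        cnt 1 (hi b) = cnt 1 (imgPos b) ∧ cnt 2 (hi b) = cnt 2 (imgPos b) := by
      obtain ⟨c, rfl⟩ : ∃ c, b = c + 1 := ⟨b - 1, by omega⟩
      rw [Nat.add_sub_cancel] at hy
      split_ifs with h2
      · obtain ⟨e, e'⟩ := hi_of_eq_one (hy.trans h2)
        rw [e]; simp [cnt_succ, e']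
      · rw [hi_of_ne_one (hy ▸ h2)]; simp
    by_cases h1 : x = 2 <;> by_cases h2 : y = 1 <;>
      simp only [h1, h2, if_true, if_false, parikhMap, Prod.fst_add, Prod.snd_add, Prod.fst_zero,
        Prod.snd_zero] at hl hr ⊢ <;> omega

/-- The sum of the entries of a Parikh vector. -/
def size (v : ℕ × ℕ × ℕ) : ℕ := v.1 + v.2.1 + v.2.2

theorem Level.mem_recurrenceBounds {v u : ℕ × ℕ × ℕ} {x y : Fin 3} (hl : Level v u x y) {n : ℕ}
    (hn : 0 < n) (hnu : n < size u + 2) : size v ∈ recurrenceBounds p n := by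
  obtain ⟨A, B, hD, hA, hB⟩ := hl
  have key : ∀ i, ∃ j, i < j ∧ j ≤ i + size v ∧ ∀ t < n, p (j + t) = p (i + t) := by
    intro i
    rcases hD i (i + n) (by omega) with ⟨a, b, hab, ha, hb⟩ | ⟨a, b, hab, ha, hb⟩
    · obtain ⟨hlt, a', haa, hw, h0, h1, h2⟩ := hA a b hab
      have s1 := cnt_sum a
      have s2 := cnt_sum a'
      refine ⟨a' + (i - a), by omega, by unfold size; omega, fun t ht => ?_⟩
      have := word_eq_iff.1 hw (i - a + t) (by omega)
      rwa [← Nat.add_assoc, show a + (i - a + t) = i + t by omega] at this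
    · have := hB a b hab
      have s1 := cnt_sum a
      have s2 := cnt_sum b
      unfold size at hnu
      omega
  refine ⟨?_, key⟩
  obtain ⟨j, h1, h2, -⟩ := key 0
  omega

/-! ### Finite verification of the base levels. -/

/-- The prefix of length `n` of `w` contains `f` away from both of its ends. -/
def HasInner (f w : List (Fin 3)) (n : ℕ) : Prop :=
  ∃ s < n, 0 < s ∧ s + f.length < n ∧ (w.drop s).take f.length = f

/-- The prefix of length `n` of `w` occurs again after a return word of length at most `16`
with Parikh vector at most `v`. -/
def HasReturn (v : ℕ × ℕ × ℕ) (w : List (Fin 3)) (n : ℕ) : Prop :=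
  ∃ d < 17, 0 < d ∧ (w.drop d).take n = w.take n ∧ (w.take d).count 0 ≤ v.1 ∧
    (w.take d).count 1 ≤ v.2.1 ∧ (w.take d).count 2 ≤ v.2.2

instance (f w : List (Fin 3)) (n : ℕ) : Decidable (HasInner f w n) := by
  unfold HasInner; infer_instance

instance (v : ℕ × ℕ × ℕ) (w : List (Fin 3)) (n : ℕ) : Decidable (HasReturn v w n) := by
  unfold HasReturn; infer_instance

/-- All short prefixes of `w` without an inner occurrence of `f` return within `v`. -/
def ReturnCheck (f : List (Fin 3)) (v : ℕ × ℕ × ℕ) (w : List (Fin 3)) : Prop :=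
  -- Length 24 leaves room to shift a prefix of at most 6 letters by at most 16; an inner occurrence
  -- within 7 letters rules out longer avoiding windows.
  24 ≤ w.length ∧ HasInner f w 7 ∧ ∀ n < 7, HasInner f w n ∨ HasReturn v w n

instance (f : List (Fin 3)) (v : ℕ × ℕ × ℕ) (w : List (Fin 3)) :
    Decidable (ReturnCheck f v w) := by
  unfold ReturnCheck; infer_instance

/-- `ReturnCheck` for all suffixes that start in the image of the first of two adjacent letters. -/
def ReturnCheckAll (f : List (Fin 3)) (v : ℕ × ℕ × ℕ) : Prop :=
  ∀ x ∈ adjacent, ∀ off < (hWord^[7] [x.1]).length,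
    ReturnCheck f v ((hWord^[7] [x.1, x.2]).drop off)

instance (f : List (Fin 3)) (v : ℕ × ℕ × ℕ) : Decidable (ReturnCheckAll f v) := by
  unfold ReturnCheckAll; infer_instance

/-- The occurrences of the word `f` in `p`. -/
def Occurrence (f : List (Fin 3)) (a b : ℕ) : Prop := b = a + f.length ∧ word a f.length = f

/-- The nonempty windows in which no occurrence of `f` is preceded and followed by a letter. -/
def Avoiding (f : List (Fin 3)) (i j : ℕ) : Prop :=
  i < j ∧ ¬ ∃ a b, Occurrence f a b ∧ i < a ∧ b < j

theorem dichotomy_avoiding (f : List (Fin 3)) : Dichotomy (Avoiding f) (Occurrence f) := by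
  intro i j hij
  by_cases hB : ∃ a b, Occurrence f a b ∧ i < a ∧ b < j
  · exact Or.inr hB
  · exact Or.inl ⟨i, j, ⟨hij, hB⟩, le_rfl, le_rfl⟩

theorem HasInner.exists_occurrence {f : List (Fin 3)} {i n N : ℕ} (hi : HasInner f (word i N) n)
    (hn : n ≤ N) : ∃ a b, Occurrence f a b ∧ i < a ∧ b < i + n := by
  obtain ⟨s, hs, hs0, hsn, e⟩ := hi
  obtain ⟨M, rfl⟩ : ∃ M, N = s + M := ⟨N - s, by omega⟩
  rw [drop_word, take_word (by omega)] at e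
  exact ⟨i + s, i + s + f.length, ⟨rfl, e⟩, by omega, by omega⟩

theorem HasReturn.returnsWithin {v : ℕ × ℕ × ℕ} {i n N : ℕ} (hr : HasReturn v (word i N) n)
    (hn : n + 16 ≤ N) : ReturnsWithin v i (i + n) := by
  obtain ⟨d, hd, hd0, e, h0, h1, h2⟩ := hr
  obtain ⟨M, rfl⟩ : ∃ M, N = d + M := ⟨N - d, by omega⟩
  rw [drop_word, take_word (by omega), take_word (by omega)] at e
  rw [take_word (by omega)] at h0 h1 h2
  refine ⟨i + d, by omega, by rwa [Nat.add_sub_cancel_left], ?_⟩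
  simp only [cnt_add]
  omega

theorem Avoiding.returnsWithin {f : List (Fin 3)} {v : ℕ × ℕ × ℕ} (hc : ReturnCheckAll f v)
    {i j : ℕ} (hij : Avoiding f i j) : ReturnsWithin v i j := by
  obtain ⟨x, hx, off, hoff, N, hN⟩ := exists_drop_iterate 7 i
  obtain ⟨hlen, h7, hr⟩ := hN ▸ hc x hx off hoff
  rw [length_word] at hlen
  obtain ⟨hlt, hno⟩ := hij
  obtain ⟨n, rfl⟩ := Nat.exists_eq_add_of_lt hlt
  have hn : n + 1 < 7 := by
    by_contra hge
    obtain ⟨a, b, hab, ha, hb⟩ := h7.exists_occurrence (by omega)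
    exact hno ⟨a, b, hab, ha, by omega⟩
  rcases hr (n + 1) hn with hin | hre
  · exact absurd (hin.exists_occurrence (by omega)) hno
  · exact hre.returnsWithin (by omega)

theorem level_of_returnCheckAll {f : List (Fin 3)} {v u : ℕ × ℕ × ℕ} {x y : Fin 3}
    (hc : ReturnCheckAll f v) (hf : f ≠ []) (hx : f.head hf = x) (hy : f.getLast hf = y)
    (hu : u = (f.count 0, f.count 1, f.count 2)) : Level v u x y := by
  refine ⟨Avoiding f, Occurrence f, dichotomy_avoiding f,
    fun a b hab => ⟨hab.1, hab.returnsWithin hc⟩, ?_⟩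
  rintro a _ ⟨rfl, hw⟩
  have hpos := List.length_pos_iff.2 hf
  have hget : ∀ t (ht : t < f.length), p (a + t) = f[t] := by
    intro t ht
    simp only [← getElem_word a f.length t (by rwa [length_word]), hw]
  refine ⟨by omega, ?_, ?_, ?_⟩
  · rw [← hx, List.head_eq_getElem, ← hget 0 hpos, Nat.add_zero]
  · rw [← hy, List.getLast_eq_getElem, ← hget _ (by omega), Nat.add_sub_assoc hpos]
  · simp [cnt_add, hw, hu]

theorem level_one : Level (4, 5, 3) (0, 1, 0) 1 1 :=
  level_of_returnCheckAll (f := [1]) (by decide +kernel) (by simp) rfl rfl rfl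

theorem level_one_zero : Level (5, 7, 4) (1, 1, 0) 1 0 :=
  level_of_returnCheckAll (f := [1, 0]) (by decide +kernel) (by simp) rfl rfl rfl

/-- The one-letter windows avoid the empty factor; they are treated directly because `Level`
requires nonempty windows in its second family. -/
theorem five_mem_recurrenceBounds : 5 ∈ recurrenceBounds p 1 := by
  refine ⟨by omega, fun i => ?_⟩
  have hA : Avoiding [] i (i + 1) := by
    refine ⟨by omega, ?_⟩
    rintro ⟨a, b, ⟨hb, -⟩, h1, h2⟩
    rw [List.length_nil] at hb
    omega
  obtain ⟨j, hj, hw, h0, h1, h2⟩ :=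
    hA.returnsWithin (v := (2, 2, 1)) (show ReturnCheckAll [] (2, 2, 1) by decide +kernel)
  have s1 := cnt_sum i
  have s2 := cnt_sum j
  rw [Nat.add_sub_cancel_left] at hw
  simp only at h0 h1 h2
  exact ⟨j, hj, by omega, word_eq_iff.1 hw⟩

/-! ### The two chains of bispecial factors. -/

/-- Parikh vectors of the bispecial factors `1, 210, 102101, …`. -/
def innerOne : ℕ → ℕ × ℕ × ℕ
  | 0 => (0, 1, 0)
  | k + 1 => parikhMap (innerOne k) + if Even k then (1, 0, 0) else (0, 1, 0)

/-- Parikh vectors of the bispecial factors `10, 2101, 102101210, …`. -/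
def innerOneZero : ℕ → ℕ × ℕ × ℕ
  | 0 => (1, 1, 0)
  | k + 1 => parikhMap (innerOneZero k) + if Even k then 0 else (1, 1, 0)

theorem level_innerOne (k : ℕ) : Level (parikhMap^[k] (4, 5, 3)) (innerOne k)
    (if Even k then 1 else 2) (if Even k then 1 else 0) := by
  induction k with
  | zero => exact level_one
  | succ k ih =>
    have := ih.succ
    rw [Function.iterate_succ_apply']
    by_cases hk : Even k <;> simpa [hk, Nat.even_add_one, innerOne] using this

theorem level_innerOneZero (k : ℕ) : Level (parikhMap^[k] (5, 7, 4)) (innerOneZero k)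
    (if Even k then 1 else 2) (if Even k then 0 else 1) := by
  induction k with
  | zero => exact level_one_zero
  | succ k ih =>
    have := ih.succ
    rw [Function.iterate_succ_apply']
    by_cases hk : Even k <;> simpa [hk, Nat.even_add_one, innerOneZero, add_assoc] using this

/-! ### Numerical bounds and the comparison of sizes. -/

theorem beta1_root : beta1 ^ 3 - 2 * beta1 ^ 2 + beta1 - 1 = 0 := (beta1_iff beta1).2 rfl

theorem beta1_bounds : 1.754877666 < beta1 ∧ beta1 < 1.754877667 := by
  have hb := beta1_root
  have h1 : 1 < beta1 := by
    by_contra hle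
    push Not at hle
    nlinarith [mul_nonneg (sub_nonneg.2 hle) (sq_nonneg (beta1 - 1)), sq_nonneg (beta1 - 1)]
  have key : ∀ y : ℝ, 1 < y → 0 < (beta1 - 1) * (beta1 - 1) + (y - 1) * (y - 1)
      + (beta1 - 1) * (y - 1) + (beta1 - 1) + (y - 1) := by
    intro y hy
    have a := sub_pos.2 h1
    have b := sub_pos.2 hy
    positivity
  constructor
  · by_contra hle
    push Not at hle
    have := mul_nonneg (sub_nonneg.2 hle) (key 1.754877666 (by norm_num)).le
    nlinarith
  · by_contra hle
    push Not at hle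
    have := mul_nonneg (sub_nonneg.2 hle) (key 1.754877667 (by norm_num)).le
    nlinarith

theorem xi_approx : |xi - 6.40431358| < 1 / 10 ^ 8 := by
  obtain ⟨h1, h2⟩ := beta1_bounds
  unfold xi
  rw [abs_lt]
  constructor <;> nlinarith

/-- A solution of the recurrence with characteristic polynomial `X³ - 2X² + X - 1` that has no
component along the dominant root stays bounded. -/
theorem bounded_of_recurrence {e : ℕ → ℝ}
    (he : ∀ k, e (k + 3) = 2 * e (k + 2) - e (k + 1) + e k)
    (h2 : e 2 = (2 - beta1) * e 1 - (beta1 - 1) ^ 2 * e 0)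
    (h0 : e 1 ^ 2 + (beta1 - 2) * e 0 * e 1 + (beta1 - 1) ^ 2 * e 0 ^ 2 ≤ 0.3) (k : ℕ) :
    -0.8 ≤ e k := by
  have hb := beta1_root
  obtain ⟨l, u⟩ := beta1_bounds
  -- The cubic factors as (X - β₁)(X² + (β₁ - 2)X + (β₁ - 1)²), because β₁(β₁ - 1)² = 1; the
  -- quadratic recurrence persists once it holds initially.
  have rec2 : ∀ k, e (k + 2) = (2 - beta1) * e (k + 1) - (beta1 - 1) ^ 2 * e k := by
    intro k
    induction k with
    | zero => exact h2
    | succ k ih =>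
      rw [he k]
      linear_combination beta1 * ih - e k * hb
  have hq : 0 ≤ (beta1 - 1) ^ 2 ∧ (beta1 - 1) ^ 2 ≤ 1 := ⟨sq_nonneg _, by nlinarith⟩
  -- This positive definite form is multiplied by (β₁ - 1)² < 1 at each step.
  have energy : ∀ k, e (k + 1) ^ 2 + (beta1 - 2) * e k * e (k + 1)
      + (beta1 - 1) ^ 2 * e k ^ 2 ≤ 0.3 := by
    intro k
    induction k with
    | zero => exact h0
    | succ k ih =>
      have : e (k + 2) ^ 2 + (beta1 - 2) * e (k + 1) * e (k + 2)
          + (beta1 - 1) ^ 2 * e (k + 1) ^ 2 = (beta1 - 1) ^ 2 * (e (k + 1) ^ 2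
          + (beta1 - 2) * e k * e (k + 1) + (beta1 - 1) ^ 2 * e k ^ 2) := by
        rw [rec2 k]; ring
      rw [show k + 1 + 1 = k + 2 from rfl, this]
      nlinarith
  have hsq : 0.5 * e k ^ 2 ≤ 0.3 := by
    have hc : 0.5 ≤ (beta1 - 1) ^ 2 - (beta1 - 2) ^ 2 / 4 := by nlinarith
    have := mul_le_mul_of_nonneg_right hc (sq_nonneg (e k))
    nlinarith [energy k, sq_nonneg (e (k + 1) + (beta1 - 2) / 2 * e k)]
  nlinarith

theorem size_iterate_parikhMap (v : ℕ × ℕ × ℕ) (k : ℕ) :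
    size (parikhMap^[k + 3] v) + size (parikhMap^[k + 1] v)
      = 2 * size (parikhMap^[k + 2] v) + size (parikhMap^[k] v) := by
  simp only [Function.iterate_succ_apply', size, parikhMap]
  omega

theorem size_innerOne (k : ℕ) : size (innerOne (k + 3)) + size (innerOne (k + 1))
    = 2 * size (innerOne (k + 2)) + size (innerOne k) + if Even k then 2 else 1 := by
  by_cases hk : Even k <;>
    simp only [innerOne, hk, Nat.even_add_one, size, parikhMap, not_true, not_false_eq_true,
      if_true, if_false, Prod.fst_add, Prod.snd_add] <;> omega

theorem size_innerOneZero (k : ℕ) : size (innerOneZero (k + 3)) + size (innerOneZero (k + 1))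
    = 2 * size (innerOneZero (k + 2)) + size (innerOneZero k) + if Even k then 0 else 3 := by
  by_cases hk : Even k <;>
    simp only [innerOneZero, hk, Nat.even_add_one, size, parikhMap, not_true, not_false_eq_true,
      if_true, if_false, Prod.fst_add, Prod.snd_add, Prod.fst_zero, Prod.snd_zero] <;> omega

theorem xi_bounds : 6.4043 < xi ∧ xi < 6.4044 := by
  have := abs_lt.1 xi_approx
  constructor <;> linarith

theorem size_iterate_le_innerOne (k : ℕ) :
    (size (parikhMap^[k] (5, 7, 4)) : ℝ) ≤ xi * (size (innerOne k) + 2 : ℕ) := by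
  obtain ⟨x1, x2⟩ := xi_bounds
  obtain ⟨l, u⟩ := beta1_bounds
  have hb := beta1_root
  -- The terms `3 / 2` and `(-1) ^ k / 10` cancel the parity-dependent inhomogeneity. Replacing them
  -- by 2 gains at least 0.4ξ, which exceeds 0.8.
  set e : ℕ → ℝ := fun k => xi * (size (innerOne k) + 3 / 2 + (-1) ^ k / 10)
      - size (parikhMap^[k] (5, 7, 4)) with he
  have e0 : e 0 = 13 / 5 * xi - 16 := by
    norm_num [he, innerOne, size, parikhMap, Nat.even_add_one]
    ring
  have e1 : e 1 = 22 / 5 * xi - 28 := by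
    norm_num [he, innerOne, size, parikhMap, Nat.even_add_one]
    ring
  have e2 : e 2 = 38 / 5 * xi - 49 := by
    norm_num [he, innerOne, size, parikhMap, Nat.even_add_one]
    ring
  have hbd := bounded_of_recurrence (e := e) ?_ ?_ ?_ k
  · push_cast
    rw [he] at hbd
    rcases neg_one_pow_eq_or ℝ k with hs | hs <;> simp only [hs] at hbd <;> nlinarith
  · intro k
    simp only [he]
    have r1 : (_ : ℝ) = _ := congrArg Nat.cast (size_innerOne k)
    have r2 : (_ : ℝ) = _ := congrArg Nat.cast (size_iterate_parikhMap (5, 7, 4) k)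
    push_cast at r1 r2
    by_cases hk : Even k
    · simp only [hk, if_true, pow_succ, hk.neg_one_pow] at r1 ⊢
      linear_combination xi * r1 - r2
    · simp only [hk, if_false, pow_succ, (Nat.not_even_iff_odd.1 hk).neg_one_pow] at r1 ⊢
      linear_combination xi * r1 - r2
  -- The value of ξ is used here: it makes the component along β₁ vanish.
  · rw [e0, e1, e2, xi]
    linear_combination (26 / 5 * beta1 + 31 / 5) * hb
  · have a1 : 0.65 < e 0 ∧ e 0 < 0.652 := by constructor <;> linarith
    have a2 : 0.178 < e 1 ∧ e 1 < 0.18 := by constructor <;> linarith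
    have t1 : e 1 ^ 2 ≤ 0.04 := by nlinarith
    have t2 : 0 ≤ (2 - beta1) * (e 0 * e 1) :=
      mul_nonneg (by linarith) (mul_nonneg (by linarith) (by linarith))
    have t3 : (beta1 - 1) ^ 2 * e 0 ^ 2 ≤ 0.57 * 0.43 :=
      mul_le_mul (by nlinarith) (by nlinarith) (sq_nonneg _) (by norm_num)
    linarith

theorem size_iterate_le_innerOneZero (k : ℕ) :
    (size (parikhMap^[k + 1] (4, 5, 3)) : ℝ) ≤ xi * (size (innerOneZero k) + 2 : ℕ) := by
  obtain ⟨x1, x2⟩ := xi_bounds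
  obtain ⟨l, u⟩ := beta1_bounds
  have hb := beta1_root
  -- The correction now matches the inhomogeneity 0, 3; the gain is at least 0.2ξ, still above 0.8.
  set e : ℕ → ℝ := fun k => xi * (size (innerOneZero k) + 3 / 2 - 3 * (-1) ^ k / 10)
      - size (parikhMap^[k + 1] (4, 5, 3)) with he
  have e0 : e 0 = 16 / 5 * xi - 21 := by
    norm_num [he, innerOneZero, size, parikhMap, Nat.even_add_one]
    ring
  have e1 : e 1 = 29 / 5 * xi - 37 := by
    norm_num [he, innerOneZero, size, parikhMap, Nat.even_add_one]
    ring
  have e2 : e 2 = 51 / 5 * xi - 65 := by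
    norm_num [he, innerOneZero, size, parikhMap, Nat.even_add_one]
    ring
  have hbd := bounded_of_recurrence (e := e) ?_ ?_ ?_ k
  · push_cast
    rw [he] at hbd
    rcases neg_one_pow_eq_or ℝ k with hs | hs <;> simp only [hs] at hbd <;> nlinarith
  · intro k
    simp only [he]
    have r1 : (_ : ℝ) = _ := congrArg Nat.cast (size_innerOneZero k)
    have r2 : (_ : ℝ) = _ := congrArg Nat.cast (size_iterate_parikhMap (4, 5, 3) (k + 1))
    push_cast at r1 r2
    by_cases hk : Even k
    · simp only [hk, if_true, pow_succ, hk.neg_one_pow] at r1 ⊢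
      linear_combination xi * r1 - r2
    · simp only [hk, if_false, pow_succ, (Nat.not_even_iff_odd.1 hk).neg_one_pow] at r1 ⊢
      linear_combination xi * r1 - r2
  · rw [e0, e1, e2, xi]
    linear_combination (32 / 5 * beta1 + 42 / 5) * hb
  · have a1 : -0.508 < e 0 ∧ e 0 < -0.505 := by constructor <;> linarith
    have a2 : 0.144 < e 1 ∧ e 1 < 0.147 := by constructor <;> linarith
    have t1 : e 1 ^ 2 ≤ 0.03 := by nlinarith
    have t2 : (2 - beta1) * (-e 0 * e 1) ≤ 0.3 * (0.6 * 0.2) :=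
      mul_le_mul (by linarith) (mul_le_mul (by linarith) (by linarith) (by linarith) (by norm_num))
        (mul_nonneg (by linarith) (by linarith)) (by norm_num)
    have t3 : (beta1 - 1) ^ 2 * e 0 ^ 2 ≤ 0.57 * 0.3 :=
      mul_le_mul (by nlinarith) (by nlinarith) (sq_nonneg _) (by norm_num)
    linarith

theorem size_innerOne_zero : size (innerOne 0) = 1 := rfl

theorem size_innerOne_strictMono : StrictMono fun k => size (innerOne k) := by
  have hmono : ∀ k, 0 < (innerOne k).2.1 ∨ 0 < (innerOne k).1 := by
    intro k
    induction k with
    | zero => left; decide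
    | succ k ih => left; simp only [innerOne, parikhMap, Prod.snd_add, Prod.fst_add]; omega
  apply strictMono_nat_of_lt_succ
  intro k
  have := hmono k
  simp only [size, innerOne, parikhMap, Prod.snd_add, Prod.fst_add]
  omega

/-! ### Covering all lengths. -/

/-- Every positive length has a recurrence bound of at most `ξ` times that length. -/
theorem exists_recurrenceBound {n : ℕ} (hn : 0 < n) :
    ∃ m ∈ recurrenceBounds p n, (m : ℝ) ≤ xi * n := by
  obtain ⟨x1, x2⟩ := xi_bounds
  have mul_mono : ∀ {a b : ℕ}, a ≤ b → xi * a ≤ xi * b := fun hab =>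
    mul_le_mul_of_nonneg_left (Nat.cast_le.2 hab) (by linarith)
  rcases (show n = 1 ∨ n = 2 ∨ 3 ≤ n by omega) with rfl | rfl | h3
  · exact ⟨5, five_mem_recurrenceBounds, by push_cast; linarith⟩
  · refine ⟨12, level_one.mem_recurrenceBounds (by omega) (by decide), by push_cast; linarith⟩
  -- Here `k` satisfies `size (innerOne k) + 2 ≤ n < size (innerOne (k + 1)) + 2`. The threshold
  -- `size (innerOneZero k) + 2` splits this range, and each part pairs the bound of one chain with
  -- a lower bound on `n` from the other.
  · obtain ⟨k, h1, h2⟩ := exists_between (f := fun k => size (innerOne k) - 1)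
      (by
        intro a b hab
        have := size_innerOne_strictMono hab
        have := size_innerOne_strictMono.monotone (Nat.zero_le a)
        simp only [size_innerOne_zero] at *
        omega) rfl (n - 3)
    have := size_innerOne_strictMono.monotone (Nat.zero_le k)
    simp only [size_innerOne_zero] at h1 h2 this
    by_cases hlt : n < size (innerOneZero k) + 2
    · exact ⟨_, (level_innerOneZero k).mem_recurrenceBounds hn hlt,
        (size_iterate_le_innerOne k).trans (mul_mono (by omega))⟩
    · exact ⟨_, (level_innerOne (k + 1)).mem_recurrenceBounds hn (by omega),
        (size_iterate_le_innerOneZero k).trans (mul_mono (by omega))⟩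

end PWord

theorem corollary10 :
    (∀ n : ℕ, (PWord.recurrenceBounds PWord.p n).Nonempty) ∧
    (∀ n : ℕ, 1 ≤ n →
      (PWord.recurrenceFunction PWord.p n : ℝ) ≤ PWord.xi * (n : ℝ)) ∧
    |PWord.xi - 6.40431358| < 1 / 10 ^ 8 := by
  refine ⟨fun n => ?_, fun n hn => ?_, PWord.xi_approx⟩
  · rcases Nat.eq_zero_or_pos n with rfl | hn
    · exact ⟨1, by omega, fun i => ⟨i + 1, by omega, by omega, by omega⟩⟩
    · obtain ⟨m, hm, -⟩ := PWord.exists_recurrenceBound hn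
      exact ⟨m, hm⟩
  · obtain ⟨m, hm, hle⟩ := PWord.exists_recurrenceBound hn
    exact (Nat.cast_le.2 (Nat.sInf_le hm)).trans hle
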